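/- For $\mu,\nu\in(0,1)$ let $g_{(\mu,\nu)}$ be the probabilistic finite-state automaton with states $s_0,s_1$ and alphabet $\{0,1\}$ that in state $s_0$ emits $0$ with probability $\mu$ and $1$ with probability $1-\mu$, in state $s_1$ emits $0$ with probability $\nu$ and $1$ with probability $1-\nu$, and after emitting $x$ moves to state $s_x$. Let M2 be the class of all these machines. The state chain of each $g\in$ M2 has a unique stationary distribution; let $p_g(\mathbf x)$ be the probability that $g$, started from a state drawn from that distribution, emits the word $\mathbf x$, and put $p_g(x\mid \mathbf x)=p_g(\mathbf x x)/p_g(\mathbf x)$. A random sequence $x_1,x_2,\dots$ in $\{0,1\}$ is generated by $g$ if $\Pr(\mathbf x^n=\mathbf w)=p_g(\mathbf w)$ for every $n\ge 0$ and every word $\mathbf w$ of length $n$, where $\mathbf x^{n}=x_1\cdots x_n$. For $g,g'\in$ M2 let $$H(g)=\lim_{n\to\infty}-\frac1n\sum_{|\mathbf w|=n}p_g(\mathbf w)\log p_g(\mathbf w),\qquad D_{\mathrm{KL}}(g\|g')=\lim_{n\to\infty}\frac1n\sum_{|\mathbf w|=n}p_g(\mathbf w)\log\frac{p_g(\mathbf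 w)}{p_{g'}(\mathbf w)},$$ with natural logarithms throughout. **Theorem.** Let $g\in$ M2. For all $g'\in$ M2 the limits defining $H(g)$ and $D_{\mathrm{KL}}(g\|g')$ exist and are finite. If $x_1,x_2,\dots$ is generated by $g$, then with probability one, for every $g'\in$ M2, $$-\frac1n\sum_{i=1}^n\log p_{g'}(x_i\mid \mathbf x^{i-1})\longrightarrow H(g)+D_{\mathrm{KL}}(g\|g')\qquad(n\to\infty).$$ -/

import Mathlib

open Filter Topology MeasureTheory

/-- A probabilistic finite-state automaton with state space `S` and alphabet `A`. -/
structure PFSA (S A : Type*) [Fintype A] where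
  /-- the state transition function -/
  next : S → A → S
  /-- `prob s x` is the probability of emitting the symbol `x` in the state `s` -/
  prob : S → A → ℝ
  prob_nonneg : ∀ s x, 0 ≤ prob s x
  sum_prob : ∀ s, ∑ x, prob s x = 1

namespace PFSA

section General

variable {S A : Type*} [Fintype S] [DecidableEq S] [Fintype A]

/-- The matrix `Γ_x`: the entry `(s, t)` is `prob s x` if `x` leads from `s` to `t`, else `0`. -/
def Gam (g : PFSA S A) (x : A) : Matrix S S ℝ :=
  Matrix.of fun s t => if g.next s x = t then g.prob s x else 0

/-- The state-to-state transition matrix. -/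
def transition (g : PFSA S A) : Matrix S S ℝ := ∑ x, g.Gam x

/-- `p` is a probability vector on the states that is invariant under the transition matrix. -/
def IsStationary (g : PFSA S A) (p : S → ℝ) : Prop :=
  (∀ s, 0 ≤ p s) ∧ ∑ s, p s = 1 ∧ Matrix.vecMul p g.transition = p

/-- The stationary distribution of the state chain (meaningful when it exists and is unique;
see `existsUnique_isStationary_of_mem_M2` below). -/
noncomputable def stationary (g : PFSA S A) : S → ℝ :=
  Classical.epsilon g.IsStationary

/-- The probability that `g`, started in the state `s`, emits the word `w`. -/
def wordProbFrom (g : PFSA S A) : S → List A → ℝ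
  | _, [] => 1
  | s, x :: w => g.prob s x * g.wordProbFrom (g.next s x) w

/-- `p_g(w)`: the probability that `g`, with its initial state drawn from the stationary
distribution, emits the word `w`. -/
noncomputable def wordProb (g : PFSA S A) (w : List A) : ℝ :=
  ∑ s, g.stationary s * g.wordProbFrom s w

/-- `p_g(x | w)`: the conditional probability that `g` emits `x` after having emitted `w`. -/
noncomputable def condProb (g : PFSA S A) (w : List A) (x : A) : ℝ :=
  g.wordProb (w ++ [x]) / g.wordProb w

/-- `H_n(g)`, the entropy (in nats) of the words of length `n` emitted by `g`. -/
noncomputable def blockEntropy (g : PFSA S A) (n : ℕ) : ℝ :=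
  -∑ w : Fin n → A, g.wordProb (List.ofFn w) * Real.log (g.wordProb (List.ofFn w))

/-- `H(g) = lim H_n(g) / n`. -/
noncomputable def entropyRate (g : PFSA S A) : ℝ :=
  limUnder atTop fun n : ℕ => (1 / (n : ℝ)) * g.blockEntropy n

/-- `D_n(g₁ ‖ g₂)`, the Kullback-Leibler divergence (in nats) on words of length `n`, for
machines that give positive probability to every word. -/
noncomputable def blockKL (g₁ g₂ : PFSA S A) (n : ℕ) : ℝ :=
  ∑ w : Fin n → A, g₁.wordProb (List.ofFn w) *
    Real.log (g₁.wordProb (List.ofFn w) / g₂.wordProb (List.ofFn w))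

/-- `D_KL(g₁ ‖ g₂) = lim D_n(g₁ ‖ g₂) / n`. -/
noncomputable def klRate (g₁ g₂ : PFSA S A) : ℝ :=
  limUnder atTop fun n : ℕ => (1 / (n : ℝ)) * blockKL g₁ g₂ n

/-- The random sequence `X 0, X 1, …` is generated by `g`: each word `w` of length `n` is the
initial segment with probability `p_g(w)`. -/
def Generates [MeasurableSpace A] (g : PFSA S A) {Ω : Type*} [MeasurableSpace Ω]
    (P : Measure Ω) (X : ℕ → Ω → A) : Prop :=
  (∀ i, Measurable (X i)) ∧
    ∀ (n : ℕ) (w : Fin n → A),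
      P {ω | ∀ i : Fin n, X i ω = w i} = ENNReal.ofReal (g.wordProb (List.ofFn w))

/-- `-(1/n) ∑_{i=1}^n log p_g(x_i | x_1 … x_{i-1})`, where `x_{i+1} = x i`. -/
noncomputable def avgNegLogLik (g : PFSA S A) (x : ℕ → A) (n : ℕ) : ℝ :=
  -(1 / (n : ℝ)) * ∑ i ∈ Finset.range n,
    Real.log (g.condProb (List.ofFn fun j : Fin i => x j) (x i))

end General

/-- The class M2 of two-state machines `g_(μ, ν)` on a binary alphabet. -/
def M2 : Set (PFSA (Fin 2) (Fin 2)) :=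
  {g | ∃ μ ∈ Set.Ioo (0 : ℝ) 1, ∃ ν ∈ Set.Ioo (0 : ℝ) 1,
    g.Gam 0 = !![μ, 0; ν, 0] ∧ g.Gam 1 = !![0, 1 - μ; 0, 1 - ν]}

theorem existsUnique_isStationary_of_mem_M2 {g : PFSA (Fin 2) (Fin 2)} (hg : g ∈ M2) :
    ∃! p, g.IsStationary p := by
  obtain ⟨μ, hμ, ν, hν, h0, h1⟩ := hg
  have hd : 0 < 1 - μ + ν := by linarith [hμ.2, hν.1]
  have key : ∀ p : Fin 2 → ℝ, g.IsStationary p ↔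
      (0 ≤ p 0 ∧ 0 ≤ p 1) ∧ p 0 + p 1 = 1 ∧
        p 0 * μ + p 1 * ν = p 0 ∧ p 0 * (1 - μ) + p 1 * (1 - ν) = p 1 := by
    intro p
    simp [IsStationary, transition, h0, h1, funext_iff, Fin.forall_fin_two, Matrix.vecHead,
      Matrix.vecTail, Fin.sum_univ_two]
  refine ⟨![ν / (1 - μ + ν), (1 - μ) / (1 - μ + ν)], ?_, ?_⟩
  · refine (key _).2 ⟨⟨div_nonneg hν.1.le hd.le, div_nonneg (by linarith [hμ.2]) hd.le⟩,
      ?_, ?_, ?_⟩ <;> simp <;> field_simp <;> ring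
  · intro p hp
    obtain ⟨-, h2, h3, -⟩ := (key p).1 hp
    have e0 : p 0 = ν / (1 - μ + ν) := by
      rw [eq_div_iff hd.ne']; linear_combination ν * h2 - h3
    have e1 : p 1 = (1 - μ) / (1 - μ + ν) := by
      rw [eq_div_iff hd.ne']; linear_combination (1 - μ) * h2 + h3
    ext i
    fin_cases i
    · simpa using e0
    · simpa using e1

end PFSA

/-! In M2 the state is the last emitted symbol, so after the first symbol the log-likelihood under
`g'` is a sum of `log (g'.prob (x i) (x (i + 1)))`, and only the frequencies of consecutive pairs
matter.

If `φ s ·` has mean zero under `g.prob s ·` for each `s`, the variables `φ (X i) (X (i+1))` are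
bounded and orthogonal, so an L² strong law makes their averages vanish. Applied to centred
indicators, this ties pair frequencies to symbol frequencies; the balance of the state chain then
forces the latter to the stationary distribution.

The almost sure limit is thus `crossEntropyRate g g'`. Bounded convergence gives the same limit in
expectation, whence `H(g) = crossEntropyRate g g` and `D(g‖g') = crossEntropyRate g g' -
crossEntropyRate g g`, which add up as claimed. -/

/-! ### Strong law for bounded orthogonal variables -/

/-- A strong law of large numbers for uniformly bounded, pairwise orthogonal random variables. -/
theorem tendsto_average_zero_of_orthogonal {Ω : Type*} [MeasurableSpace Ω] (P : Measure Ω)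
    [IsProbabilityMeasure P] (Y : ℕ → Ω → ℝ) (hY : ∀ i, Measurable (Y i)) (C : ℝ)
    (hC : ∀ i ω, |Y i ω| ≤ C) (horth : ∀ i j, i < j → ∫ ω, Y i ω * Y j ω ∂P = 0) :
    ∀ᵐ ω ∂P, Tendsto (fun n : ℕ => (∑ i ∈ Finset.range n, Y i ω) / (n : ℝ)) atTop (𝓝 0) := by
  have hint : ∀ i j, Integrable (fun ω => Y i ω * Y j ω) P := fun i j =>
    Integrable.of_bound ((hY i).mul (hY j)).aestronglyMeasurable (C * C) <| .of_forall fun ω => by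
      rw [norm_mul]
      exact mul_le_mul (hC i ω) (hC j ω) (norm_nonneg _) ((abs_nonneg _).trans (hC i ω))
  have hsq : ∀ n : ℕ, ∫ ω, (∑ i ∈ Finset.range n, Y i ω) ^ 2 ∂P ≤ n * (C * C) := by
    intro n
    have h1 : ∫ ω, (∑ i ∈ Finset.range n, Y i ω) ^ 2 ∂P
        = ∑ i ∈ Finset.range n, ∫ ω, Y i ω * Y i ω ∂P := by
      simp_rw [sq, Finset.sum_mul_sum]
      rw [integral_finsetSum _ fun i _ => integrable_finsetSum _ fun j _ => hint i j]
      refine Finset.sum_congr rfl fun i hi => ?_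
      rw [integral_finsetSum _ fun j _ => hint i j]
      refine Finset.sum_eq_single_of_mem i hi fun j _ hji => ?_
      rcases lt_or_gt_of_ne hji with h | h
      · simpa [mul_comm] using horth j i h
      · exact horth i j h
    rw [h1]
    calc _ ≤ ∑ i ∈ Finset.range n, C * C := by
          refine Finset.sum_le_sum fun i _ => ?_
          calc _ ≤ ∫ _ω, C * C ∂P := integral_mono (hint i i) (integrable_const _) fun ω => by
                have := hC i ω
                simpa using mul_le_mul this this (abs_nonneg _) ((abs_nonneg _).trans this)
            _ = _ := by simp
      _ = _ := by simp
  have hmeas : ∀ n : ℕ, Measurable fun ω => (∑ i ∈ Finset.range n, Y i ω) / (n : ℝ) := fun n =>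
    (Finset.measurable_sum _ fun i _ => hY i).div_const _
  have hSC : ∀ (n : ℕ) ω, |∑ i ∈ Finset.range n, Y i ω| ≤ n * C := fun n ω =>
    (Finset.abs_sum_le_sum_abs _ _).trans <|
      (Finset.sum_le_sum fun i _ => hC i ω).trans (by simp)
  -- Along `k ^ 2` the second moments are at most `C * C / k ^ 2`, hence summable, so the series of
  -- squares is almost surely finite and its terms tend to zero.
  have hsquares : ∀ᵐ ω ∂P, Tendsto
      (fun k : ℕ => (∑ i ∈ Finset.range (k ^ 2), Y i ω) / ((k ^ 2 : ℕ) : ℝ)) atTop (𝓝 0) := by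
    have hsum : Summable fun k : ℕ => C * C * (1 / (k : ℝ) ^ 2) :=
      (Real.summable_one_div_nat_pow.2 one_lt_two).mul_left _
    have hlin : ∀ k : ℕ, ∫⁻ ω, ENNReal.ofReal
        (((∑ i ∈ Finset.range (k ^ 2), Y i ω) / ((k ^ 2 : ℕ) : ℝ)) ^ 2) ∂P
          ≤ ENNReal.ofReal (C * C * (1 / (k : ℝ) ^ 2)) := by
      intro k
      have hb : Integrable (fun ω => (∑ i ∈ Finset.range (k ^ 2), Y i ω) ^ 2) P := by
        simp_rw [sq (Finset.sum _ _), Finset.sum_mul_sum]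
        exact integrable_finsetSum _ fun i _ => integrable_finsetSum _ fun j _ => hint i j
      simp_rw [div_pow]
      rw [← ofReal_integral_eq_lintegral_ofReal (hb.div_const _)
        (.of_forall fun ω => by positivity), integral_div]
      refine ENNReal.ofReal_le_ofReal ?_
      rcases Nat.eq_zero_or_pos k with rfl | hk
      · simp
      · have hk' : (0 : ℝ) < k := by exact_mod_cast hk
        rw [div_le_iff₀ (by positivity)]
        refine (hsq _).trans (le_of_eq ?_)
        push_cast
        field_simp
    have hfin : ∫⁻ ω, ∑' k : ℕ, ENNReal.ofReal
        (((∑ i ∈ Finset.range (k ^ 2), Y i ω) / ((k ^ 2 : ℕ) : ℝ)) ^ 2) ∂P ≠ ⊤ := by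
      rw [lintegral_tsum fun k => ((hmeas _).pow_const 2).ennreal_ofReal.aemeasurable]
      refine ne_top_of_le_ne_top ?_ (ENNReal.tsum_le_tsum hlin)
      exact hsum.tsum_ofReal_ne_top
    filter_upwards [ae_lt_top (Measurable.tsum fun k =>
      ((hmeas _).pow_const 2).ennreal_ofReal) hfin] with ω hω
    have h0 := ENNReal.tendsto_atTop_zero_of_tsum_ne_top hω.ne
    have h1 := (ENNReal.tendsto_toReal ENNReal.zero_ne_top).comp h0
    have h2 : Tendsto (fun k : ℕ =>
        ((∑ i ∈ Finset.range (k ^ 2), Y i ω) / ((k ^ 2 : ℕ) : ℝ)) ^ 2) atTop (𝓝 0) := by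
      refine h1.congr fun k => ?_
      simp only [Function.comp]
      rw [ENNReal.toReal_ofReal (by positivity)]
    have h3 := h2.sqrt
    simp only [Real.sqrt_sq_eq_abs, Real.sqrt_zero] at h3
    exact (tendsto_zero_iff_abs_tendsto_zero _).2 h3
  filter_upwards [hsquares] with ω hω
  have hsqrt : Tendsto Nat.sqrt atTop atTop := by
    refine tendsto_atTop.2 fun b => ?_
    filter_upwards [eventually_ge_atTop (b * b)] with n hn using Nat.le_sqrt.2 hn
  -- With `k = Nat.sqrt n`, at most `2 * k` terms lie between `k ^ 2` and `n`; after division by `k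
  -- ^ 2` they cost at most `2 * C / k`.
  have hbound : Tendsto (fun k : ℕ => |(∑ i ∈ Finset.range (k ^ 2), Y i ω) / ((k ^ 2 : ℕ) : ℝ)|
      + 2 * C / (k : ℝ)) atTop (𝓝 0) := by
    simpa using hω.abs.add (tendsto_const_div_atTop_nhds_zero_nat (2 * C))
  refine squeeze_zero_norm' ?_ (hbound.comp hsqrt)
  filter_upwards [eventually_gt_atTop 0] with n hn
  have hk : 0 < Nat.sqrt n := Nat.sqrt_pos.2 hn
  have hkn : Nat.sqrt n ^ 2 ≤ n := Nat.sqrt_le' n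
  have hnk : n ≤ Nat.sqrt n ^ 2 + 2 * Nat.sqrt n := by
    have := Nat.sqrt_le_add n
    nlinarith
  simp only [Function.comp]
  generalize Nat.sqrt n = k at hk hkn hnk
  have hC0 : 0 ≤ C := (abs_nonneg _).trans (hC 0 ω)
  have hk' : (0 : ℝ) < k := by exact_mod_cast hk
  have hkn' : (k : ℝ) ^ 2 ≤ n := by exact_mod_cast hkn
  have hnk' : (n : ℝ) - (k : ℝ) ^ 2 ≤ 2 * k := by
    have : (n : ℝ) ≤ (k : ℝ) ^ 2 + 2 * k := by exact_mod_cast hnk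
    linarith
  have hdiff : |∑ i ∈ Finset.Ico (k ^ 2) n, Y i ω| ≤ 2 * k * C := by
    refine (Finset.abs_sum_le_sum_abs _ _).trans <|
      (Finset.sum_le_sum fun i _ => hC i ω).trans ?_
    rw [Finset.sum_const, Nat.card_Ico, nsmul_eq_mul, Nat.cast_sub hkn]
    push_cast
    exact mul_le_mul_of_nonneg_right hnk' hC0
  rw [← Finset.sum_range_add_sum_Ico _ hkn, Real.norm_eq_abs, abs_div, abs_div, Nat.abs_cast,
    Nat.abs_cast]
  push_cast
  calc _ ≤ (|∑ i ∈ Finset.range (k ^ 2), Y i ω| + 2 * k * C) / (k : ℝ) ^ 2 := by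
        gcongr
        exact (abs_add_le _ _).trans (add_le_add_right hdiff _)
    _ = _ := by field_simp

/-! ### Markov structure of the machines in M2 -/

namespace PFSA

section Structure

variable {g : PFSA (Fin 2) (Fin 2)}

theorem next_eq_of_mem_M2 (hg : g ∈ M2) (s x : Fin 2) : g.next s x = x := by
  obtain ⟨μ, hμ, ν, hν, h0, h1⟩ := hg
  have key : ∀ s t : Fin 2, g.Gam t s t ≠ 0 := by
    intro s t
    have := hμ.1; have := hμ.2; have := hν.1; have := hν.2
    fin_cases s <;> fin_cases t <;> simp [h0, h1] <;> linarith
  by_contra h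
  exact key s x (by simp [Gam, h])

theorem prob_pos_of_mem_M2 (hg : g ∈ M2) (s x : Fin 2) : 0 < g.prob s x := by
  have hn := next_eq_of_mem_M2 hg
  obtain ⟨μ, hμ, ν, hν, h0, h1⟩ := hg
  have e : g.prob s x = g.Gam x s x := by simp [Gam, hn]
  have := hμ.1; have := hμ.2; have := hν.1; have := hν.2
  rw [e]
  fin_cases s <;> fin_cases x <;> simp [h0, h1] <;> linarith

theorem isStationary_stationary (hg : g ∈ M2) : g.IsStationary g.stationary :=
  Classical.epsilon_spec (existsUnique_isStationary_of_mem_M2 hg).exists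

theorem wordProbFrom_pos (hg : g ∈ M2) (s : Fin 2) (w : List (Fin 2)) :
    0 < g.wordProbFrom s w := by
  induction w generalizing s with
  | nil => exact one_pos
  | cons x w ih => exact mul_pos (prob_pos_of_mem_M2 hg s x) (ih _)

theorem wordProb_pos (hg : g ∈ M2) (w : List (Fin 2)) : 0 < g.wordProb w := by
  obtain ⟨h0, h1, -⟩ := isStationary_stationary hg
  refine Finset.sum_pos' (fun s _ => mul_nonneg (h0 s) (wordProbFrom_pos hg s w).le) ?_
  obtain ⟨s, -, hs⟩ : ∃ s ∈ Finset.univ, 0 < g.stationary s := by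
    by_contra! h
    linarith [Finset.sum_nonpos h]
  exact ⟨s, Finset.mem_univ _, mul_pos hs (wordProbFrom_pos hg s w)⟩

theorem wordProb_nil (hg : g ∈ M2) : g.wordProb [] = 1 := by
  simpa [wordProb, wordProbFrom] using (isStationary_stationary hg).2.1

/-- Emitting `s` leads to the state `s` whatever came before, so the last factor is independent of
`r` and `w` and survives averaging over the initial state. -/
theorem wordProbFrom_append_pair (hg : g ∈ M2) (r : Fin 2) (w : List (Fin 2)) (s x : Fin 2) :
    g.wordProbFrom r (w ++ [s] ++ [x]) = g.wordProbFrom r (w ++ [s]) * g.prob s x := by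
  induction w generalizing r with
  | nil => simp [wordProbFrom, next_eq_of_mem_M2 hg]
  | cons y w ih =>
    simp only [List.cons_append, wordProbFrom]
    rw [ih, mul_assoc]

theorem wordProb_append_pair (hg : g ∈ M2) (w : List (Fin 2)) (s x : Fin 2) :
    g.wordProb (w ++ [s] ++ [x]) = g.wordProb (w ++ [s]) * g.prob s x := by
  simp only [wordProb, wordProbFrom_append_pair hg, Finset.sum_mul, mul_assoc]

theorem condProb_append_singleton (hg : g ∈ M2) (w : List (Fin 2)) (s x : Fin 2) :
    g.condProb (w ++ [s]) x = g.prob s x := by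
  rw [condProb, wordProb_append_pair hg, mul_div_cancel_left₀ _ (wordProb_pos hg _).ne']

theorem ofFn_prefix_succ (x : ℕ → Fin 2) (n : ℕ) :
    (List.ofFn fun j : Fin (n + 1) => x j) = (List.ofFn fun j : Fin n => x j) ++ [x n] := by
  rw [List.ofFn_succ', List.concat_eq_append]
  rfl

theorem avgNegLogLik_eq_log_wordProb (hg : g ∈ M2) (x : ℕ → Fin 2) (n : ℕ) :
    g.avgNegLogLik x n
      = -(1 / (n : ℝ)) * Real.log (g.wordProb (List.ofFn fun j : Fin n => x j)) := by
  rw [avgNegLogLik]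
  congr 1
  induction n with
  | zero => simp [wordProb_nil hg]
  | succ n ih =>
    rw [Finset.sum_range_succ, ih, ofFn_prefix_succ, condProb,
      Real.log_div (wordProb_pos hg _).ne' (wordProb_pos hg _).ne']
    ring

theorem avgNegLogLik_succ (hg : g ∈ M2) (x : ℕ → Fin 2) (n : ℕ) :
    g.avgNegLogLik x (n + 1) = -(Real.log (g.wordProb [x 0])
      + ∑ i ∈ Finset.range n, Real.log (g.prob (x i) (x (i + 1)))) / ((n : ℝ) + 1) := by
  have h : ∀ i, g.condProb (List.ofFn fun j : Fin (i + 1) => x j) (x (i + 1))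
      = g.prob (x i) (x (i + 1)) := fun i => by
    rw [ofFn_prefix_succ, condProb_append_singleton hg]
  have h0 : g.condProb (List.ofFn fun j : Fin 0 => x j) (x 0) = g.wordProb [x 0] := by
    simp [condProb, wordProb_nil hg]
  rw [avgNegLogLik, Finset.sum_range_succ', h0]
  simp_rw [h]
  push_cast
  ring

end Structure

/-! ### Orthogonality of centred pair functions -/

section Random

variable {g : PFSA (Fin 2) (Fin 2)} {Ω : Type*} [MeasurableSpace Ω] {P : Measure Ω}
  [IsProbabilityMeasure P] {X : ℕ → Ω → Fin 2}

theorem Generates.integral_prefix (hg : g ∈ M2) (hX : g.Generates P X) (n : ℕ)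
    (h : (Fin n → Fin 2) → ℝ) :
    ∫ ω, h (fun i => X i ω) ∂P = ∑ w, g.wordProb (List.ofFn w) * h w := by
  have hm : Measurable fun ω => fun i : Fin n => X i ω := measurable_pi_lambda _ fun i => hX.1 i
  have : IsProbabilityMeasure (P.map fun ω => fun i : Fin n => X i ω) :=
    Measure.isProbabilityMeasure_map hm.aemeasurable
  rw [← integral_map (f := h) hm.aemeasurable (Measurable.of_discrete).aestronglyMeasurable,
    integral_fintype Integrable.of_finite]
  refine Finset.sum_congr rfl fun w _ => ?_
  rw [measureReal_def, Measure.map_apply hm (measurableSet_singleton w)]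
  have e : (fun ω => fun i : Fin n => X i ω) ⁻¹' {w} = {ω | ∀ i : Fin n, X i ω = w i} := by
    ext ω; simp [funext_iff]
  rw [e, hX.2, ENNReal.toReal_ofReal (wordProb_pos hg _).le, smul_eq_mul]

/-- Summing over the last symbol first: given the prefix, `φ (X m) (X (m+1))` has mean zero. -/
theorem Generates.integral_prefix_mul_eq_zero (hg : g ∈ M2) (hX : g.Generates P X) (m : ℕ)
    (h : (Fin (m + 1) → Fin 2) → ℝ) (φ : Fin 2 → Fin 2 → ℝ)
    (hφ : ∀ s, ∑ t, g.prob s t * φ s t = 0) :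
    ∫ ω, h (fun i => X i ω) * φ (X m ω) (X (m + 1) ω) ∂P = 0 := by
  have := hX.integral_prefix hg (m + 2)
    fun w => h (fun i => w i.castSucc) * φ (w (Fin.last m).castSucc) (w (Fin.last (m + 1)))
  simp only [Fin.val_castSucc, Fin.val_last] at this
  rw [this, ← (Fin.snocEquiv fun _ : Fin (m + 2) => Fin 2).sum_comp, Fintype.sum_prod_type,
    Finset.sum_comm]
  refine Finset.sum_eq_zero fun w _ => ?_
  have hw : ∀ t, g.wordProb (List.ofFn ((Fin.snocEquiv fun _ : Fin (m + 2) => Fin 2) (t, w)))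
      = g.wordProb (List.ofFn w) * g.prob (w (Fin.last m)) t := fun t => by
    have e : List.ofFn w = (List.ofFn fun i : Fin m => w i.castSucc) ++ [w (Fin.last m)] := by
      rw [List.ofFn_succ', List.concat_eq_append]
    have e' : List.ofFn ((Fin.snocEquiv fun _ : Fin (m + 2) => Fin 2) (t, w))
        = List.ofFn w ++ [t] := by
      rw [List.ofFn_succ', List.concat_eq_append]
      simp [Fin.snocEquiv]
    rw [e', e, wordProb_append_pair hg]
  simp_rw [hw]
  simp only [Fin.snocEquiv_apply, Fin.snoc_castSucc, Fin.snoc_last]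
  calc _ = ∑ t, g.wordProb (List.ofFn w) * h w
        * (g.prob (w (Fin.last m)) t * φ (w (Fin.last m)) t) :=
        Finset.sum_congr rfl fun t _ => by ring
    _ = 0 := by rw [← Finset.mul_sum, hφ, mul_zero]

theorem Generates.tendsto_average_zero (hg : g ∈ M2) (hX : g.Generates P X)
    (φ : Fin 2 → Fin 2 → ℝ) (hφ : ∀ s, ∑ t, g.prob s t * φ s t = 0) :
    ∀ᵐ ω ∂P, Tendsto (fun n : ℕ => (∑ i ∈ Finset.range n, φ (X i ω) (X (i + 1) ω)) / (n : ℝ))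
      atTop (𝓝 0) := by
  refine tendsto_average_zero_of_orthogonal P (fun i ω => φ (X i ω) (X (i + 1) ω)) (fun i => ?_)
    (∑ s, ∑ t, |φ s t|) (fun i ω => ?_) fun i j hij => ?_
  · exact (Measurable.of_discrete (f := fun q : Fin 2 × Fin 2 => φ q.1 q.2)).comp
      ((hX.1 i).prodMk (hX.1 (i + 1)))
  · exact (Finset.single_le_sum (f := fun t => |φ (X i ω) t|) (fun _ _ => abs_nonneg _)
      (Finset.mem_univ (X (i + 1) ω))).trans <|
        Finset.single_le_sum (f := fun s => ∑ t, |φ s t|)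
          (fun _ _ => Finset.sum_nonneg fun _ _ => abs_nonneg _) (Finset.mem_univ (X i ω))
  -- Since `i + 1 ≤ j`, the earlier pair lies within the prefix of length `j + 1`.
  · exact hX.integral_prefix_mul_eq_zero hg j
      (fun w => φ (w ⟨i, by omega⟩) (w ⟨i + 1, by omega⟩)) φ hφ

end Random

end PFSA

namespace PFSA

/-! ### Pair frequencies, entropy and divergence rates -/

section Limits

variable {g : PFSA (Fin 2) (Fin 2)} {Ω : Type*} [MeasurableSpace Ω] {P : Measure Ω}
  [IsProbabilityMeasure P] {X : ℕ → Ω → Fin 2}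

theorem sum_stationary_mul_prob (hg : g ∈ M2) (t : Fin 2) :
    ∑ s, g.stationary s * g.prob s t = g.stationary t := by
  have h := congrFun (isStationary_stationary hg).2.2 t
  simpa [transition, Gam, Matrix.vecMul, dotProduct, Matrix.sum_apply, next_eq_of_mem_M2 hg]
    using h

/-- The expectation of `ψ` on two consecutive states of the stationary state chain. -/
noncomputable def pairMean (g : PFSA (Fin 2) (Fin 2)) (ψ : Fin 2 → Fin 2 → ℝ) : ℝ :=
  ∑ s, ∑ t, ψ s t * (g.prob s t * g.stationary s)

/-- Only four centred indicators are used to choose the null set; every `ψ` is a linear combination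
of pair indicators, so one null set serves all `ψ`, hence later all `g'`. -/
theorem Generates.tendsto_average_pair (hg : g ∈ M2) (hX : g.Generates P X) :
    ∀ᵐ ω ∂P, ∀ ψ : Fin 2 → Fin 2 → ℝ,
      Tendsto (fun n : ℕ => (∑ i ∈ Finset.range n, ψ (X i ω) (X (i + 1) ω)) / (n : ℝ)) atTop
        (𝓝 (g.pairMean ψ)) := by
  have hae : ∀ᵐ ω ∂P, ∀ u t : Fin 2, Tendsto (fun n : ℕ => (∑ i ∈ Finset.range n,
      if X i ω = u then (if X (i + 1) ω = t then 1 else 0) - g.prob u t else 0) / (n : ℝ))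
      atTop (𝓝 0) := by
    refine ae_all_iff.2 fun u => ae_all_iff.2 fun t => ?_
    refine hX.tendsto_average_zero hg
      (fun s x => if s = u then (if x = t then 1 else 0) - g.prob u t else 0) fun s => ?_
    by_cases h : s = u
    · subst h
      simp [mul_sub, ← Finset.sum_mul, g.sum_prob]
    · simp [h]
  filter_upwards [hae] with ω hω
  let x : ℕ → Fin 2 := fun i => X i ω
  let f : Fin 2 → ℕ → ℝ := fun s n => (∑ i ∈ Finset.range n, if x i = s then 1 else 0) / (n : ℝ)
  let q : Fin 2 → Fin 2 → ℕ → ℝ := fun u t n =>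
    (∑ i ∈ Finset.range n, if x i = u then (if x (i + 1) = t then 1 else 0) else 0) / (n : ℝ)
  have hq : ∀ u t, Tendsto (fun n => q u t n - g.prob u t * f u n) atTop (𝓝 0) := by
    refine fun u t => (hω u t).congr fun n => ?_
    simp only [q, f, x]
    rw [← mul_div_assoc, ← sub_div, Finset.mul_sum, ← Finset.sum_sub_distrib]
    congr 1
    refine Finset.sum_congr rfl fun i _ => ?_
    split_ifs <;> simp
  -- Counting zeros at times `i + 1` instead of `i` changes the count by at most one.
  have hshift : Tendsto (fun n => q 0 0 n + q 1 0 n - f 0 n) atTop (𝓝 0) := by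
    have e : ∀ n : ℕ, q 0 0 n + q 1 0 n - f 0 n
        = ((if x n = 0 then 1 else 0) - if x 0 = 0 then 1 else 0) / (n : ℝ) := fun n => by
      simp only [q, f]
      rw [← add_div, ← sub_div, ← Finset.sum_range_sub (fun i => if x i = 0 then (1 : ℝ) else 0),
        ← Finset.sum_add_distrib, ← Finset.sum_sub_distrib]
      congr 1
      refine Finset.sum_congr rfl fun i _ => ?_
      generalize x i = a
      fin_cases a <;> simp
    refine squeeze_zero_norm (fun n => ?_) (tendsto_const_div_atTop_nhds_zero_nat (1 : ℝ))
    rw [e, norm_div, Real.norm_natCast]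
    gcongr
    split_ifs <;> simp
  have hf1 : ∀ᶠ n in atTop, f 0 n + f 1 n = 1 := by
    filter_upwards [eventually_gt_atTop 0] with n hn
    have hn' : (n : ℝ) ≠ 0 := by exact_mod_cast hn.ne'
    simp only [f]
    rw [← add_div, ← Finset.sum_add_distrib, div_eq_one_iff_eq hn']
    have : ∀ i, ((if x i = 0 then 1 else 0) + if x i = 1 then 1 else 0 : ℝ) = 1 := fun i => by
      generalize x i = a
      fin_cases a <;> simp
    simp [this]
  have hπ1 : g.stationary 0 + g.stationary 1 = 1 := by
    simpa using (isStationary_stationary hg).2.1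
  have hπ := sum_stationary_mul_prob hg 0
  have hp : g.prob 0 0 + g.prob 0 1 = 1 := by simpa using g.sum_prob 0
  rw [Fin.sum_univ_two] at hπ
  have hf0 : Tendsto (f 0) atTop (𝓝 (g.stationary 0)) := by
    have hd : g.prob 0 1 + g.prob 1 0 ≠ 0 :=
      (add_pos (prob_pos_of_mem_M2 hg 0 1) (prob_pos_of_mem_M2 hg 1 0)).ne'
    -- The `q` terms cancel, leaving `g.prob 1 0 - d * f 0 n` for large `n`, where `d` is the
    -- divisor; stationarity says `g.prob 1 0 / d = g.stationary 0`.
    have h := ((hshift.sub (hq 0 0)).sub (hq 1 0)).div_const (g.prob 0 1 + g.prob 1 0)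
    have h' := h.const_sub (g.stationary 0)
    simp only [sub_zero, zero_div] at h'
    refine h'.congr' ?_
    filter_upwards [hf1] with n hn
    field_simp
    linear_combination -g.prob 1 0 * hn + g.prob 1 0 * hπ1 - hπ
      + (g.stationary 0 - f 0 n) * hp
  have hf : ∀ s, Tendsto (f s) atTop (𝓝 (g.stationary s)) := by
    refine Fin.forall_fin_two.2 ⟨hf0, ?_⟩
    rw [show g.stationary 1 = 1 - g.stationary 0 by linarith]
    refine (hf0.const_sub 1).congr' ?_
    filter_upwards [hf1] with n hn
    linarith
  have hq' : ∀ u t, Tendsto (q u t) atTop (𝓝 (g.prob u t * g.stationary u)) := fun u t => by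
    simpa using (hq u t).add ((hf u).const_mul (g.prob u t))
  intro ψ
  have hlim : Tendsto (fun n => ∑ s, ∑ t, ψ s t * q s t n) atTop (𝓝 (g.pairMean ψ)) :=
    tendsto_finsetSum _ fun s _ => tendsto_finsetSum _ fun t _ => (hq' s t).const_mul _
  refine hlim.congr fun n => ?_
  simp only [q, ← mul_div_assoc, ← Finset.sum_div, Finset.mul_sum]
  congr 1
  simp_rw [Finset.sum_comm (t := Finset.range n)]
  refine Finset.sum_congr rfl fun i _ => ?_
  simp [x]

/-- The limit of the average negative log-likelihood of `g'` along the output of `g`. -/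
noncomputable def crossEntropyRate (g g' : PFSA (Fin 2) (Fin 2)) : ℝ :=
  -g.pairMean fun s t => Real.log (g'.prob s t)

theorem Generates.tendsto_avgNegLogLik (hg : g ∈ M2) (hX : g.Generates P X) :
    ∀ᵐ ω ∂P, ∀ g' ∈ M2, Tendsto (fun n : ℕ => g'.avgNegLogLik (fun i => X i ω) n) atTop
      (𝓝 (crossEntropyRate g g')) := by
  filter_upwards [hX.tendsto_average_pair hg] with ω hω g' hg'
  -- At length `n + 1` there are `n` pairs and one initial term; the factor `n / (n + 1)` corrects
  -- the normalisation.
  refine (tendsto_add_atTop_iff_nat 1).1 ?_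
  have h1 := hω fun s t => Real.log (g'.prob s t)
  have h2 := tendsto_const_div_atTop_nhds_zero_nat (Real.log (g'.wordProb [X 0 ω]))
  have h3 := (h2.add h1).mul (tendsto_natCast_div_add_atTop (1 : ℝ))
  rw [zero_add, mul_one] at h3
  refine h3.neg.congr' ?_
  filter_upwards [eventually_gt_atTop 0] with n hn
  have hn' : (n : ℝ) ≠ 0 := by exact_mod_cast hn.ne'
  rw [avgNegLogLik_succ hg']
  field_simp

theorem exists_abs_avgNegLogLik_le {g' : PFSA (Fin 2) (Fin 2)} (hg' : g' ∈ M2) :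
    ∃ C, ∀ x n, |g'.avgNegLogLik x n| ≤ C := by
  let C : ℝ := ∑ s, |Real.log (g'.wordProb [s])| + ∑ s, ∑ t, |Real.log (g'.prob s t)|
  have hC : 0 ≤ C := by positivity
  refine ⟨C, fun x n => ?_⟩
  cases n with
  | zero => simpa [avgNegLogLik] using hC
  | succ n =>
    have h0 : |Real.log (g'.wordProb [x 0])| ≤ C :=
      (Finset.single_le_sum (f := fun s => |Real.log (g'.wordProb [s])|)
        (fun _ _ => abs_nonneg _) (Finset.mem_univ (x 0))).trans
        (le_add_of_nonneg_right (by positivity))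
    have h1 : ∀ s t, |Real.log (g'.prob s t)| ≤ C := fun s t =>
      ((Finset.single_le_sum (f := fun t => |Real.log (g'.prob s t)|)
        (fun _ _ => abs_nonneg _) (Finset.mem_univ t)).trans
        (Finset.single_le_sum (f := fun s => ∑ t, |Real.log (g'.prob s t)|)
          (fun _ _ => by positivity) (Finset.mem_univ s))).trans
        (le_add_of_nonneg_left (by positivity))
    have hn : (0 : ℝ) < (n : ℝ) + 1 := by positivity
    rw [avgNegLogLik_succ hg', abs_div, abs_neg, abs_of_pos hn, div_le_iff₀ hn]
    calc _ ≤ C + ∑ i ∈ Finset.range n, C := (abs_add_le _ _).trans <| add_le_add h0 <|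
          (Finset.abs_sum_le_sum_abs _ _).trans (Finset.sum_le_sum fun i _ => h1 _ _)
      _ = _ := by simp; ring

/-- The left side is the expectation of `avgNegLogLik`, so the almost sure limit passes to it by
dominated convergence. -/
theorem Generates.tendsto_sum_wordProb_mul_log (hg : g ∈ M2) (hX : g.Generates P X)
    {g' : PFSA (Fin 2) (Fin 2)} (hg' : g' ∈ M2) :
    Tendsto (fun n : ℕ => -(1 / (n : ℝ)) * ∑ w : Fin n → Fin 2,
      g.wordProb (List.ofFn w) * Real.log (g'.wordProb (List.ofFn w))) atTop
      (𝓝 (crossEntropyRate g g')) := by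
  obtain ⟨C, hC⟩ := exists_abs_avgNegLogLik_le hg'
  have hmeas : ∀ n, Measurable fun ω => g'.avgNegLogLik (fun i => X i ω) n := fun n => by
    simp_rw [avgNegLogLik_eq_log_wordProb hg']
    exact (Measurable.of_discrete (f := fun w : Fin n → Fin 2 =>
      -(1 / (n : ℝ)) * Real.log (g'.wordProb (List.ofFn w)))).comp
        (measurable_pi_lambda _ fun i => hX.1 i)
  have hlim := tendsto_integral_of_dominated_convergence (μ := P)
    (F := fun n ω => g'.avgNegLogLik (fun i => X i ω) n) (f := fun _ => crossEntropyRate g g')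
    (fun _ => C) (fun n => (hmeas n).aestronglyMeasurable) (integrable_const C)
    (fun n => .of_forall fun ω => hC _ n)
    ((hX.tendsto_avgNegLogLik hg).mono fun ω h => h g' hg')
  rw [integral_const, probReal_univ, one_smul] at hlim
  refine hlim.congr fun n => ?_
  simp_rw [avgNegLogLik_eq_log_wordProb hg']
  rw [integral_const_mul, hX.integral_prefix hg n fun w => Real.log (g'.wordProb (List.ofFn w))]

theorem Generates.tendsto_blockEntropy (hg : g ∈ M2) (hX : g.Generates P X) :
    Tendsto (fun n : ℕ => (1 / (n : ℝ)) * g.blockEntropy n) atTop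
      (𝓝 (crossEntropyRate g g)) := by
  refine (hX.tendsto_sum_wordProb_mul_log hg hg).congr fun n => ?_
  rw [blockEntropy]
  ring

theorem Generates.tendsto_blockKL (hg : g ∈ M2) (hX : g.Generates P X)
    {g' : PFSA (Fin 2) (Fin 2)} (hg' : g' ∈ M2) :
    Tendsto (fun n : ℕ => (1 / (n : ℝ)) * blockKL g g' n) atTop
      (𝓝 (crossEntropyRate g g' - crossEntropyRate g g)) := by
  refine ((hX.tendsto_sum_wordProb_mul_log hg hg').sub
    (hX.tendsto_sum_wordProb_mul_log hg hg)).congr fun n => ?_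
  simp_rw [blockKL, Real.log_div (wordProb_pos hg _).ne' (wordProb_pos hg' _).ne', mul_sub,
    Finset.sum_sub_distrib]
  ring

end Limits

end PFSA

theorem mainTheorem2 {Ω : Type*} [MeasurableSpace Ω] (P : Measure Ω) [IsProbabilityMeasure P]
    (g : PFSA (Fin 2) (Fin 2)) (hg : g ∈ PFSA.M2)
    (X : ℕ → Ω → Fin 2) (hX : g.Generates P X) :
    Tendsto (fun n : ℕ => (1 / (n : ℝ)) * g.blockEntropy n) atTop (𝓝 g.entropyRate) ∧
    (∀ g' ∈ PFSA.M2, Tendsto (fun n : ℕ => (1 / (n : ℝ)) * PFSA.blockKL g g' n) atTop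
      (𝓝 (PFSA.klRate g g'))) ∧
    ∀ᵐ ω ∂P, ∀ g' ∈ PFSA.M2,
      Tendsto (fun n : ℕ => g'.avgNegLogLik (fun i => X i ω) n) atTop
        (𝓝 (g.entropyRate + PFSA.klRate g g')) := by
  have hH := hX.tendsto_blockEntropy hg
  have hD := fun g' (hg' : g' ∈ PFSA.M2) => hX.tendsto_blockKL hg hg'
  refine ⟨tendsto_nhds_limUnder ⟨_, hH⟩, fun g' hg' => tendsto_nhds_limUnder ⟨_, hD g' hg'⟩, ?_⟩
  filter_upwards [hX.tendsto_avgNegLogLik hg] with ω hω g' hg'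
  rw [PFSA.entropyRate, PFSA.klRate, hH.limUnder_eq, (hD g' hg').limUnder_eq,
    add_sub_cancel]
  exact hω g' hg'
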